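/- Let $\mathcal A$ be a complex unital Banach algebra with $\|1_{\mathcal A}\|=1$, let $\mathbb D$ be the open unit disk in $\mathbb C$, and let $\{F_t\}_{t\ge 0}$ be a one-parameter continuous semigroup of holomorphic self-mappings of $\mathbb D$ (jointly continuous in $(t,z)\in[0,\infty)\times\mathbb D$, with $F_{t+s}=F_t\circ F_s$ and $F_0=\mathrm{id}$). Let $f\in\mathrm{Hol}(\mathbb D,\mathbb C)$, $f(z)=\lim_{t\to0^+}(F_t(z)-z)/t$, be its generator, and assume that $f(z_0)=0$ for some $z_0\in\mathbb D$ and that $\lambda:=-f'(z_0)$ satisfies $\operatorname{Re}\lambda>0$. Then there is a Kœnigs function of the semigroup, that is, a univalent function $h\in\mathrm{Hol}(\mathbb D,\mathbb C)$ with $$h(F_t(z))=e^{-\lambda t}h(z)\quad(t\ge 0,\ z\in\mathbb D),\qquad h(z_0)=0,\qquad h'(z_0)=1.$$ Let $B\in\mathrm{Hol}(\mathbb D,\mathcal A)$, put $B_0=B(z_0)$, let $h$ be the Kœnigs function, and let $b_k\in\mathcal A$ be the Taylor coefficients at $0$ of $B\circ h^{-1}$, so that $B(h^{-1}(w))=B_0+\sum_{k\ge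 1}b_kw^k$ near $w=0$. Let $\{\Gamma_t\}_{t\ge 0}$ be the semicocycle over $\{F_t\}_{t\ge0}$ generated by $B$; that is, $\Gamma_t\in\mathrm{Hol}(\mathbb D,\mathcal A)$, $(t,z)\mapsto\Gamma_t(z)$ is continuous, $\Gamma_t(F_s(z))\Gamma_s(z)=\Gamma_{t+s}(z)$, and $$\frac{d}{dt}\Gamma_t(z)=B(F_t(z))\Gamma_t(z),\qquad \Gamma_0(z)=1_{\mathcal A}\qquad(t,s\ge 0,\ z\in\mathbb D).$$ Then $\{\Gamma_t\}_{t\ge0}$ is linearizable, i.e. there are $C\in\mathcal A$ and a holomorphic mapping $M$ from $\mathbb D$ into the set of invertible elements of $\mathcal A$ such that $$\Gamma_t(z)=M(F_t(z))^{-1}e^{tC}M(z)\qquad\text{for all } t\ge 0,\ z\in\mathbb D,$$ if and only if there is a sequence $(m_k)_{k\ge 0}$ in $\mathcal A$ with $m_0=1_{\mathcal A}$ and $$k\lambda\, m_k-(m_kB_0-B_0m_k)=\sum_{l=0}^{k-1}m_l\,b_{k-l}\qquad\text{for all } k\ge 0.$$ -/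

import Mathlib

open Set Filter Topology

noncomputable section

/-- The open unit disk of the complex plane. -/
abbrev unitDisk : Set ℂ := Metric.ball (0 : ℂ) 1

/-- One-parameter continuous semigroups of holomorphic self-mappings of the unit disk.
Only the values `F t z` with `0 ≤ t` and `z ∈ unitDisk` are relevant. -/
structure IsHolSemigroup (F : ℝ → ℂ → ℂ) : Prop where
  holomorphic : ∀ t, 0 ≤ t → DifferentiableOn ℂ (F t) unitDisk
  mapsTo : ∀ t, 0 ≤ t → MapsTo (F t) unitDisk unitDisk
  continuous : ContinuousOn (fun p : ℝ × ℂ => F p.1 p.2) (Ici (0 : ℝ) ×ˢ unitDisk)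
  add : ∀ t s, 0 ≤ t → 0 ≤ s → ∀ z ∈ unitDisk, F (t + s) z = F t (F s z)
  zero : ∀ z ∈ unitDisk, F 0 z = z

/-- `f ∈ Hol(𝔻, ℂ)` is the infinitesimal generator of the semigroup `F`. -/
structure IsSemigroupGenerator (F : ℝ → ℂ → ℂ) (f : ℂ → ℂ) : Prop where
  holomorphic : DifferentiableOn ℂ f unitDisk
  tendsto : ∀ z ∈ unitDisk,
    Tendsto (fun t : ℝ => (F t z - z) / (t : ℂ)) (𝓝[>] (0 : ℝ)) (𝓝 (f z))

/-- `h` is the Kœnigs function of the semigroup `F` at the interior fixed point `z₀`,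
where `lam = -f'(z₀)` for the generator `f` of `F`. -/
structure IsKoenigsFunction (F : ℝ → ℂ → ℂ) (z₀ lam : ℂ) (h : ℂ → ℂ) : Prop where
  holomorphic : DifferentiableOn ℂ h unitDisk
  univalent : InjOn h unitDisk
  schroeder : ∀ t : ℝ, 0 ≤ t → ∀ z ∈ unitDisk, h (F t z) = Complex.exp (-lam * t) * h z
  map_fixed : h z₀ = 0
  deriv_fixed : deriv h z₀ = 1

section Algebra

variable {A : Type*} [NormedRing A] [NormedAlgebra ℂ A]

/-- Holomorphic `A`-valued semicocycles over the semigroup `F`. -/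
structure IsSemicocycle (F : ℝ → ℂ → ℂ) (Γ : ℝ → ℂ → A) : Prop where
  holomorphic : ∀ t, 0 ≤ t → DifferentiableOn ℂ (Γ t) unitDisk
  continuous : ContinuousOn (fun p : ℝ × ℂ => Γ p.1 p.2) (Ici (0 : ℝ) ×ˢ unitDisk)
  chain : ∀ t s, 0 ≤ t → 0 ≤ s → ∀ z ∈ unitDisk, Γ t (F s z) * Γ s z = Γ (t + s) z
  zero : ∀ z ∈ unitDisk, Γ 0 z = 1

/-- `Γ` is generated by `B`: it solves `dΓ_t(z)/dt = B(F_t(z)) Γ_t(z)`, `Γ_0(z) = 1`,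
for `t ≥ 0` and `z` in the disk (with the right derivative at `t = 0`). -/
def IsSemicocycleGeneratedBy (F : ℝ → ℂ → ℂ) (Γ : ℝ → ℂ → A) (B : ℂ → A) : Prop :=
  ∀ z ∈ unitDisk, Γ 0 z = 1 ∧
    ∀ t : ℝ, 0 ≤ t →
      HasDerivWithinAt (fun s : ℝ => Γ s z) (B (F t z) * Γ t z) (Ici (0 : ℝ)) t

/-- `Γ_t(z) = M(F_t(z))⁻¹ e^{tC} M(z)` for some `C ∈ A` and some holomorphic mapping `M` of the
disk into the group of invertible elements of `A`. -/
def IsLinearizable (F : ℝ → ℂ → ℂ) (Γ : ℝ → ℂ → A) : Prop :=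
  ∃ (C : A) (M : ℂ → A), DifferentiableOn ℂ M unitDisk ∧ (∀ z ∈ unitDisk, IsUnit (M z)) ∧
    ∀ t : ℝ, 0 ≤ t → ∀ z ∈ unitDisk,
      Γ t z = Ring.inverse (M (F t z)) * NormedSpace.exp ((t : ℂ) • C) * M z

/-- The `k`-th Taylor coefficient at `0` of `B ∘ h⁻¹`, where `h⁻¹ : h(𝔻) → 𝔻` is the inverse of
the univalent function `h` on the disk. -/
def koenigsCoeff (B : ℂ → A) (h : ℂ → ℂ) (k : ℕ) : A :=
  ((k.factorial : ℂ)⁻¹) • iteratedDeriv k (fun w : ℂ => B (Function.invFunOn h unitDisk w)) 0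

/-- Solvability of
`k lam m_k - (m_k B₀ - B₀ m_k) = ∑_{l < k} m_l b_{k-l}`, `k ≥ 0`, with `m_0 = 1`. -/
def RecSolvable (lam : ℂ) (B₀ : A) (b : ℕ → A) : Prop :=
  ∃ m : ℕ → A, m 0 = 1 ∧ ∀ k : ℕ,
    ((k : ℂ) * lam) • m k - (m k * B₀ - B₀ * m k) = ∑ l ∈ Finset.range k, m l * b (k - l)

end Algebra

end

/-! Differentiating `M(F_t) Γ_t = e^{tC} M` at `t = 0` gives `f M' + M B = C M`, and `intertwine`
recovers the intertwining relation from this equation by constancy of `e^{-tC} M(F_t) Γ_t`.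
Normalising `M(z₀) = 1` forces `C = B₀`. The Kœnigs function satisfies `h' f = -λ h`, so in the
coordinate `w = h(z)` the equation for `n = M ∘ h⁻¹`, with `b = B ∘ h⁻¹`, becomes `λ w n' - n b + B₀
n = 0`. Its Taylor coefficients are exactly the recursion (`taylorCoeff_residual`), which settles
necessity.

For sufficiency, `w = 0` is a regular singular point: `kλ` eventually dominates the commutator with
`B₀`, so every formal solution converges (`exists_norm_le_of_recursion`). This linearizes `Γ` only
where `|h| < r`, a forward invariant set that every orbit enters. The cocycle identity then makes
`e^{-tC} n(h(F_t z)) Γ_t(z)` independent of the entry time `t`, and this expression is the global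
`M`.

The Kœnigs function itself comes from solving `h' f = -λ h`, where `f / (z - z₀)` has no zeros. Its
univalence follows from local injectivity, the Schröder equation and convergence of all orbits to
`z₀`. -/

noncomputable section

/-! ### Power series solutions of the singular equation at the origin. -/

section TaylorCoefficients

variable {A : Type*} [NormedRing A] [NormedAlgebra ℂ A]

/-- The `k`-th Taylor coefficient at `0` of an `A`-valued function. -/
def taylorCoeff (u : ℂ → A) (k : ℕ) : A := ((k.factorial : ℂ)⁻¹) • iteratedDeriv k u 0

theorem taylorCoeff_zero (u : ℂ → A) : taylorCoeff u 0 = u 0 := by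
  simp [taylorCoeff]

theorem taylorCoeff_mul {u v : ℂ → A} (hu : ContDiffAt ℂ ⊤ u 0) (hv : ContDiffAt ℂ ⊤ v 0)
    (k : ℕ) :
    taylorCoeff (fun w => u w * v w) k =
      ∑ l ∈ Finset.range (k + 1), taylorCoeff u l * taylorCoeff v (k - l) := by
  unfold taylorCoeff
  rw [iteratedDeriv_fun_mul (hu.of_le le_top) (hv.of_le le_top), Finset.smul_sum]
  refine Finset.sum_congr rfl fun l hl => ?_
  have hl' : l ≤ k := Nat.lt_succ_iff.mp (Finset.mem_range.mp hl)
  rw [smul_mul_smul_comm, mul_assoc, ← nsmul_eq_mul, ← Nat.cast_smul_eq_nsmul ℂ, smul_smul,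
    Nat.cast_choose ℂ hl']
  congr 1
  have h1 : (k.factorial : ℂ) ≠ 0 := by exact_mod_cast k.factorial_ne_zero
  have h2 : (l.factorial : ℂ) ≠ 0 := by exact_mod_cast l.factorial_ne_zero
  have h3 : ((k - l).factorial : ℂ) ≠ 0 := by exact_mod_cast (k - l).factorial_ne_zero
  field_simp

theorem taylorCoeff_id_smul_deriv {u : ℂ → A} (hu : ContDiffAt ℂ ⊤ (deriv u) 0) (k : ℕ) :
    taylorCoeff (fun w => w • deriv u w) k = (k : ℂ) • taylorCoeff u k := by
  unfold taylorCoeff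
  have h := iteratedDerivWithin_smul (n := k) (s := univ) (f := fun w : ℂ => w) (g := deriv u)
    (mem_univ (0 : ℂ)) uniqueDiffOn_univ contDiffWithinAt_id
    ((hu.of_le le_top).contDiffWithinAt)
  simp only [iteratedDerivWithin_univ, iteratedDeriv_fun_id_zero] at h
  have h' : iteratedDeriv k (fun w => w • deriv u w) 0 = (k : ℂ) • iteratedDeriv k u 0 := by
    refine Eq.trans ?_ (h.trans ?_)
    · rfl
    · rcases k with _ | k
      · simp
      -- In the Leibniz sum only the first derivative of the identity survives at `0`.
      · rw [Finset.sum_eq_single 1]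
        · simp [iteratedDeriv_succ', ← Nat.cast_smul_eq_nsmul ℂ]
        · intro i _ hi
          simp [hi]
        · simp
  rw [h', smul_comm]

/-- Taylor coefficients of the residual of the equation `lam w n' - n b + b(0) n = 0`. -/
theorem taylorCoeff_residual [CompleteSpace A] {n b : ℂ → A} (hn : AnalyticAt ℂ n 0)
    (hb : AnalyticAt ℂ b 0) (lam : ℂ) (k : ℕ) :
    taylorCoeff (fun w => lam • (w • deriv n w) - n w * b w + b 0 * n w) k =
      ((k : ℂ) * lam) • taylorCoeff n k
        - (taylorCoeff n k * b 0 - b 0 * taylorCoeff n k)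
        - ∑ l ∈ Finset.range k, taylorCoeff n l * taylorCoeff b (k - l) := by
  have hn' := hn.contDiffAt (n := ⊤)
  have hb' := hb.contDiffAt (n := ⊤)
  have hd' := hn.deriv.contDiffAt (n := ⊤)
  have h1 : ContDiffAt ℂ k (fun w => w • deriv n w) 0 :=
    contDiffAt_id.smul (hd'.of_le le_top)
  have h2 : ContDiffAt ℂ k (fun w => lam • (w • deriv n w)) 0 := h1.const_smul lam
  have h3 : ContDiffAt ℂ k (fun w => n w * b w) 0 :=
    (hn'.of_le le_top).mul (hb'.of_le le_top)
  have h4 : ContDiffAt ℂ k (fun w => b 0 * n w) 0 :=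
    contDiffAt_const.mul (hn'.of_le le_top)
  have e : taylorCoeff (fun w => lam • (w • deriv n w) - n w * b w + b 0 * n w) k =
      lam • taylorCoeff (fun w => w • deriv n w) k - taylorCoeff (fun w => n w * b w) k
        + b 0 * taylorCoeff n k := by
    unfold taylorCoeff
    have e1 := iteratedDeriv_add (h2.sub h3) h4
    have e2 : iteratedDeriv k (fun w => lam • (w • deriv n w) - n w * b w) 0 = _ :=
      iteratedDeriv_sub h2 h3
    have e3 : iteratedDeriv k (fun w => lam • (w • deriv n w)) 0 = _ :=
      iteratedDeriv_const_smul h1 lam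
    have e4 : iteratedDeriv k (fun w => b 0 * n w) 0 = _ :=
      iteratedDeriv_const_mul (b 0) (hn'.of_le le_top)
    refine (congrArg _ (e1.trans (by rw [e2, e3, e4]))).trans ?_
    rw [smul_add, smul_sub, mul_smul_comm, smul_comm lam]
  -- The top term `l = k` of the Cauchy product is `n_k b(0)`, one half of the commutator.
  rw [e, taylorCoeff_id_smul_deriv hd', taylorCoeff_mul hn' hb', Finset.sum_range_succ,
    Nat.sub_self, taylorCoeff_zero b, smul_smul, mul_comm lam]
  abel

theorem exists_norm_taylorCoeff_le [CompleteSpace A] {b : ℂ → A} (hb : AnalyticAt ℂ b 0) :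
    ∃ K R : ℝ, 0 < K ∧ 0 < R ∧ ∀ k, ‖taylorCoeff b k‖ ≤ K * R ^ k := by
  obtain ⟨r, hr, hd⟩ := Metric.eventually_nhds_iff_ball.mp hb.eventually_analyticAt
  have hsub : Metric.closedBall (0 : ℂ) (r / 2) ⊆ Metric.ball 0 r :=
    Metric.closedBall_subset_ball (by linarith)
  have hc : ContinuousOn b (Metric.closedBall 0 (r / 2)) := fun z hz =>
    (hd z (hsub hz)).continuousAt.continuousWithinAt
  obtain ⟨K, hK⟩ := (isCompact_closedBall (0 : ℂ) (r / 2)).exists_bound_of_continuousOn hc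
  -- Cauchy estimates on the circle of radius `r / 2`; the maximum with `1` keeps the constant
  -- positive, so that it can be cancelled later.
  refine ⟨max K 1, (r / 2)⁻¹, by positivity, by positivity, fun k => ?_⟩
  have hdc : DiffContOnCl ℂ b (Metric.ball 0 (r / 2)) := by
    apply DifferentiableOn.diffContOnCl
    intro z hz
    have hz' := hsub (Metric.closure_ball_subset_closedBall hz)
    exact (hd z hz').differentiableAt.differentiableWithinAt
  have := Complex.norm_iteratedDeriv_le_of_forall_mem_sphere_norm_le k (by positivity) hdc
    (C := max K 1) fun z hz => (hK z (Metric.sphere_subset_closedBall hz)).trans (le_max_left _ _)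
  have hk : (0 : ℝ) < k.factorial := by exact_mod_cast k.factorial_pos
  rw [taylorCoeff, norm_smul, norm_inv, Complex.norm_natCast, inv_mul_le_iff₀ hk]
  refine this.trans_eq ?_
  rw [inv_pow]
  field_simp

/-- Solutions of the recursion grow at most geometrically. -/
theorem exists_norm_le_of_recursion {lam : ℂ} (hlam : lam ≠ 0) {B₀ : A} {b m : ℕ → A}
    {K R : ℝ} (hK : 0 < K) (hR : 0 < R) (hb : ∀ k, ‖b k‖ ≤ K * R ^ k)
    (hm : ∀ k : ℕ, ((k : ℂ) * lam) • m k - (m k * B₀ - B₀ * m k)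
      = ∑ l ∈ Finset.range k, m l * b (k - l)) :
    ∃ C ρ : ℝ, 0 < ρ ∧ ∀ k, ‖m k‖ ≤ C * ρ ^ k := by
  have hl : 0 < ‖lam‖ := norm_pos_iff.mpr hlam
  -- From `k₀` on, the left side of the recursion has norm at least `K ‖m k‖`. The sum `C` below
  -- covers the indices before `k₀`. With rate `2R` the convolution is at most `C K R^k (2^k - 1)`,
  -- so the induction closes with the same `C`.
  obtain ⟨k₀, hk₀⟩ := exists_nat_gt ((K + 2 * ‖B₀‖) / ‖lam‖)
  rw [div_lt_iff₀ hl] at hk₀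
  set C : ℝ := ∑ j ∈ Finset.range k₀, ‖m j‖ / (2 * R) ^ j with hC
  have hC0 : 0 ≤ C := Finset.sum_nonneg fun j _ => by positivity
  refine ⟨C, 2 * R, by positivity, fun k => ?_⟩
  induction k using Nat.strong_induction_on with
  | _ k ih =>
    rcases lt_or_ge k k₀ with hk | hk
    · rw [← div_le_iff₀ (by positivity)]
      exact Finset.single_le_sum (f := fun j => ‖m j‖ / (2 * R) ^ j)
        (fun j _ => by positivity) (Finset.mem_range.mpr hk)
    · have hgeom : ∀ k : ℕ, ∑ l ∈ Finset.range k, (2 : ℝ) ^ l = 2 ^ k - 1 := fun k => by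
        induction k with
        | zero => simp
        | succ k ih => rw [Finset.sum_range_succ, ih]; ring
      have hsum : ‖∑ l ∈ Finset.range k, m l * b (k - l)‖ ≤ K * (C * (2 * R) ^ k) := by
        calc ‖∑ l ∈ Finset.range k, m l * b (k - l)‖
            ≤ ∑ l ∈ Finset.range k, (C * (2 * R) ^ l) * (K * R ^ (k - l)) := by
              refine norm_sum_le_of_le _ fun l hl => ?_
              refine (norm_mul_le _ _).trans ?_
              exact mul_le_mul (ih l (Finset.mem_range.mp hl)) (hb _) (norm_nonneg _)
                (by positivity)
          _ = ∑ l ∈ Finset.range k, (C * K * R ^ k) * 2 ^ l := by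
              refine Finset.sum_congr rfl fun l hl => ?_
              have : R ^ k = R ^ l * R ^ (k - l) := by
                rw [← pow_add, Nat.add_sub_cancel' (Finset.mem_range.mp hl).le]
              rw [this, mul_pow]; ring
          _ = (C * K * R ^ k) * (2 ^ k - 1) := by rw [← Finset.mul_sum, hgeom]
          _ ≤ (C * K * R ^ k) * 2 ^ k := by
              apply mul_le_mul_of_nonneg_left (by linarith) (by positivity)
          _ = K * (C * (2 * R) ^ k) := by rw [mul_pow]; ring
      have hlow : (k * ‖lam‖ - 2 * ‖B₀‖) * ‖m k‖ ≤ ‖∑ l ∈ Finset.range k, m l * b (k - l)‖ := by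
        rw [← hm k]
        have h1 : ‖((k : ℂ) * lam) • m k‖ = k * ‖lam‖ * ‖m k‖ := by
          rw [norm_smul, norm_mul, Complex.norm_natCast]
        have h2 : ‖m k * B₀ - B₀ * m k‖ ≤ 2 * ‖B₀‖ * ‖m k‖ := by
          refine (norm_sub_le _ _).trans ?_
          have := norm_mul_le (m k) B₀
          have := norm_mul_le B₀ (m k)
          linarith
        have h3 := norm_sub_norm_le (((k : ℂ) * lam) • m k) (m k * B₀ - B₀ * m k)
        linarith
      have hkK : K ≤ k * ‖lam‖ - 2 * ‖B₀‖ := by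
        have : (k₀ : ℝ) * ‖lam‖ ≤ k * ‖lam‖ :=
          mul_le_mul_of_nonneg_right (by exact_mod_cast hk) hl.le
        linarith
      have h5 : K * ‖m k‖ ≤ K * (C * (2 * R) ^ k) :=
        (mul_le_mul_of_nonneg_right hkK (norm_nonneg _)).trans (hlow.trans hsum)
      exact le_of_mul_le_mul_left h5 hK

theorem exists_analyticAt_taylorCoeff_eq [CompleteSpace A] {m : ℕ → A} {C ρ : ℝ} (hρ : 0 < ρ)
    (hm : ∀ k, ‖m k‖ ≤ C * ρ ^ k) :
    ∃ n : ℂ → A, AnalyticAt ℂ n 0 ∧ ∀ k, taylorCoeff n k = m k := by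
  let p : FormalMultilinearSeries ℂ ℂ A := fun k =>
    ContinuousMultilinearMap.mkPiRing ℂ (Fin k) (m k)
  have hrad : ((Real.toNNReal ρ⁻¹ : NNReal) : ENNReal) ≤ p.radius := by
    apply p.le_radius_of_bound C
    intro k
    rw [ContinuousMultilinearMap.norm_mkPiRing, Real.coe_toNNReal _ (by positivity), inv_pow,
      ← div_eq_mul_inv, div_le_iff₀ (by positivity)]
    exact hm k
  have hpos : 0 < p.radius := by
    refine lt_of_lt_of_le ?_ hrad
    simpa using hρ
  have hs := p.hasFPowerSeriesOnBall hpos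
  refine ⟨p.sum, hs.analyticAt, fun k => ?_⟩
  have h := hs.factorial_smul (1 : ℂ) k
  have hk : (k.factorial : ℂ) ≠ 0 := by exact_mod_cast k.factorial_ne_zero
  rw [taylorCoeff, iteratedDeriv_eq_iteratedFDeriv, ← h, ← Nat.cast_smul_eq_nsmul ℂ,
    inv_smul_smul₀ hk]
  simp [p]

theorem eventuallyEq_zero_of_taylorCoeff [CompleteSpace A] {u : ℂ → A} (hu : AnalyticAt ℂ u 0)
    (h : ∀ k, taylorCoeff u k = 0) : ∀ᶠ w in 𝓝 0, u w = 0 := by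
  obtain ⟨r, hr, hd⟩ := Metric.eventually_nhds_iff_ball.mp hu.eventually_analyticAt
  filter_upwards [Metric.ball_mem_nhds (0 : ℂ) hr] with w hw
  have hs := Complex.hasSum_taylorSeries_on_ball
    (fun z hz => (hd z hz).differentiableAt.differentiableWithinAt) hw
  refine hs.unique ?_
  convert hasSum_zero with k
  rw [smul_comm]
  have := h k
  rw [taylorCoeff] at this
  rw [this, smul_zero]

/-- A formal power series solution of `lam w n' - n b + b(0) n = 0` converges near the origin. -/
theorem exists_analyticAt_solution [CompleteSpace A] {lam : ℂ} (hlam : lam ≠ 0) {b : ℂ → A}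
    (hb : AnalyticAt ℂ b 0) (h : RecSolvable lam (b 0) (taylorCoeff b)) :
    ∃ n : ℂ → A, AnalyticAt ℂ n 0 ∧ n 0 = 1 ∧
      ∀ᶠ w in 𝓝 0, lam • (w • deriv n w) - n w * b w + b 0 * n w = 0 := by
  obtain ⟨m, hm0, hm⟩ := h
  obtain ⟨K, R, hK, hR, hbb⟩ := exists_norm_taylorCoeff_le hb
  obtain ⟨C, ρ, hρ, hmm⟩ := exists_norm_le_of_recursion hlam hK hR hbb hm
  obtain ⟨n, hn, hnm⟩ := exists_analyticAt_taylorCoeff_eq hρ hmm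
  refine ⟨n, hn, by rw [← taylorCoeff_zero n, hnm, hm0], ?_⟩
  refine eventuallyEq_zero_of_taylorCoeff ?_ fun k => ?_
  · exact (((analyticAt_id.smul hn.deriv).const_smul (c := lam)).sub (hn.mul hb)).add
      (analyticAt_const.mul hn)
  · rw [taylorCoeff_residual hn hb]
    simp only [hnm, hm k, sub_self]

theorem recSolvable_of_analyticAt_solution [CompleteSpace A] {lam : ℂ} {b n : ℂ → A}
    (hb : AnalyticAt ℂ b 0) (hn : AnalyticAt ℂ n 0) (hn0 : n 0 = 1)
    (h : ∀ᶠ w in 𝓝 0, lam • (w • deriv n w) - n w * b w + b 0 * n w = 0) :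
    RecSolvable lam (b 0) (taylorCoeff b) := by
  refine ⟨taylorCoeff n, by rw [taylorCoeff_zero, hn0], fun k => ?_⟩
  have h1 := taylorCoeff_residual hn hb lam k
  have h2 : taylorCoeff (fun w => lam • (w • deriv n w) - n w * b w + b 0 * n w) k = 0 := by
    rw [taylorCoeff, Filter.EventuallyEq.iteratedDeriv_eq k (g := fun _ => (0 : A)) h]
    simp
  rw [h2] at h1
  exact sub_eq_zero.mp h1.symm

end TaylorCoefficients

/-! ### Schwarz–Pick for self-maps of the disk with a fixed point. -/

section Moebius

/-- The disk automorphism `z ↦ (z - a) / (1 - \bar a z)`. -/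
def diskMoebius (a z : ℂ) : ℂ := (z - a) / (1 - (starRingEnd ℂ) a * z)

theorem mem_unitDisk {z : ℂ} : z ∈ unitDisk ↔ ‖z‖ < 1 := mem_ball_zero_iff

theorem one_sub_conj_mul_ne_zero {a z : ℂ} (ha : a ∈ unitDisk) (hz : z ∈ unitDisk) :
    1 - (starRingEnd ℂ) a * z ≠ 0 := by
  intro h
  have h1 : ‖(starRingEnd ℂ) a * z‖ = 1 := by rw [← sub_eq_zero.mp h, norm_one]
  rw [norm_mul, RCLike.norm_conj] at h1
  nlinarith [mem_unitDisk.mp ha, mem_unitDisk.mp hz, norm_nonneg a, norm_nonneg z]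

theorem differentiableOn_diskMoebius {a : ℂ} (ha : a ∈ unitDisk) :
    DifferentiableOn ℂ (diskMoebius a) unitDisk := by
  unfold diskMoebius
  exact DifferentiableOn.div (by fun_prop) (by fun_prop)
    fun z hz => one_sub_conj_mul_ne_zero ha hz

theorem mapsTo_diskMoebius {a : ℂ} (ha : a ∈ unitDisk) :
    MapsTo (diskMoebius a) unitDisk unitDisk := by
  intro z hz
  have hne := one_sub_conj_mul_ne_zero ha hz
  rw [mem_unitDisk, diskMoebius, norm_div, div_lt_one (norm_pos_iff.mpr hne)]
  refine lt_of_pow_lt_pow_left₀ 2 (norm_nonneg _) ?_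
  have ha' : Complex.normSq a < 1 := by
    rw [Complex.normSq_eq_norm_sq]; nlinarith [mem_unitDisk.mp ha, norm_nonneg a]
  have hz' : Complex.normSq z < 1 := by
    rw [Complex.normSq_eq_norm_sq]; nlinarith [mem_unitDisk.mp hz, norm_nonneg z]
  rw [← Complex.normSq_eq_norm_sq, ← Complex.normSq_eq_norm_sq]
  have : Complex.normSq (1 - (starRingEnd ℂ) a * z) - Complex.normSq (z - a)
      = (1 - Complex.normSq a) * (1 - Complex.normSq z) := by
    simp only [Complex.normSq_apply, Complex.sub_re, Complex.sub_im, Complex.mul_re,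
      Complex.mul_im, Complex.conj_re, Complex.conj_im, Complex.one_re, Complex.one_im]
    ring
  nlinarith [mul_pos (sub_pos.mpr ha') (sub_pos.mpr hz')]

theorem diskMoebius_self (a : ℂ) : diskMoebius a a = 0 := by simp [diskMoebius]

theorem diskMoebius_neg_zero (a : ℂ) : diskMoebius (-a) 0 = a := by simp [diskMoebius]

theorem neg_mem_unitDisk {a : ℂ} (ha : a ∈ unitDisk) : -a ∈ unitDisk := by
  rwa [mem_unitDisk, norm_neg, ← mem_unitDisk]

theorem diskMoebius_neg_diskMoebius {a z : ℂ} (ha : a ∈ unitDisk) (hz : z ∈ unitDisk) :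
    diskMoebius (-a) (diskMoebius a z) = z := by
  have h1 := one_sub_conj_mul_ne_zero ha hz
  have h3 := one_sub_conj_mul_ne_zero (neg_mem_unitDisk ha) (mapsTo_diskMoebius ha hz)
  have hq : diskMoebius a z * (1 - (starRingEnd ℂ) a * z) = z - a := div_mul_cancel₀ _ h1
  rw [diskMoebius, div_eq_iff h3, map_neg]
  linear_combination hq

/-- The conjugate of a self-map of the disk fixing `a` by the Moebius map moving `a` to `0`. -/
theorem conj_diskMoebius {a : ℂ} (ha : a ∈ unitDisk) {G : ℂ → ℂ}
    (hd : DifferentiableOn ℂ G unitDisk) (hm : MapsTo G unitDisk unitDisk) (hfix : G a = a) :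
    DifferentiableOn ℂ (fun w => diskMoebius a (G (diskMoebius (-a) w))) unitDisk ∧
    MapsTo (fun w => diskMoebius a (G (diskMoebius (-a) w))) unitDisk unitDisk ∧
    diskMoebius a (G (diskMoebius (-a) 0)) = 0 := by
  have ha' := neg_mem_unitDisk ha
  refine ⟨?_, ?_, ?_⟩
  · exact (differentiableOn_diskMoebius ha).comp
      (hd.comp (differentiableOn_diskMoebius ha') (mapsTo_diskMoebius ha'))
      (hm.comp (mapsTo_diskMoebius ha'))
  · exact (mapsTo_diskMoebius ha).comp (hm.comp (mapsTo_diskMoebius ha'))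
  · rw [diskMoebius_neg_zero, hfix, diskMoebius_self]

/-- The Schwarz lemma for the conjugated map: pseudo-hyperbolic disks about a fixed point are
invariant. -/
theorem norm_diskMoebius_apply_le {a z : ℂ} (ha : a ∈ unitDisk) (hz : z ∈ unitDisk) {G : ℂ → ℂ}
    (hd : DifferentiableOn ℂ G unitDisk) (hm : MapsTo G unitDisk unitDisk) (hfix : G a = a) :
    ‖diskMoebius a (G z)‖ ≤ ‖diskMoebius a z‖ := by
  obtain ⟨h1, h2, h3⟩ := conj_diskMoebius ha hd hm hfix
  have := Complex.norm_le_norm_of_mapsTo_ball h1 (h2.mono_right Metric.ball_subset_closedBall) h3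
    (mem_unitDisk.mp (mapsTo_diskMoebius ha hz))
  simpa only [diskMoebius_neg_diskMoebius ha hz] using this

/-- A holomorphic self-map of the disk with two fixed points is the identity. -/
theorem eqOn_id_of_two_fixed {a b : ℂ} (ha : a ∈ unitDisk) (hb : b ∈ unitDisk) (hab : b ≠ a)
    {G : ℂ → ℂ} (hd : DifferentiableOn ℂ G unitDisk) (hm : MapsTo G unitDisk unitDisk)
    (hfa : G a = a) (hfb : G b = b) : EqOn G id unitDisk := by
  obtain ⟨h1, h2, h3⟩ := conj_diskMoebius ha hd hm hfa
  set H : ℂ → ℂ := fun w => diskMoebius a (G (diskMoebius (-a) w)) with hH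
  have hinj : ∀ {x y : ℂ}, x ∈ unitDisk → y ∈ unitDisk →
      diskMoebius a x = diskMoebius a y → x = y := fun hx hy hxy => by
    rw [← diskMoebius_neg_diskMoebius ha hx, hxy, diskMoebius_neg_diskMoebius ha hy]
  set β := diskMoebius a b with hβ
  have hβD : β ∈ unitDisk := mapsTo_diskMoebius ha hb
  have hβ0 : β ≠ 0 := fun h => hab (hinj hb ha (by rw [← hβ, h, diskMoebius_self]))
  have hHβ : H β = β := by
    simp only [hH, hβ, diskMoebius_neg_diskMoebius ha hb, hfb]
  -- The second fixed point attains equality in the Schwarz lemma, so `H` is affine, hence the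
  -- identity.
  have hslope : dslope H 0 β = 1 := by
    rw [dslope_of_ne _ hβ0, slope_def_field, hHβ]
    have h3' : H 0 = 0 := h3
    rw [h3', sub_zero, div_self hβ0]
  have h2' : MapsTo H (Metric.ball 0 1) (Metric.closedBall (H 0) 1) := by
    have h3' : H 0 = 0 := h3
    rw [h3']
    exact h2.mono_right Metric.ball_subset_closedBall
  have haff := Complex.affine_of_mapsTo_ball_of_norm_dslope_eq_div h1 h2' hβD
    (by rw [hslope]; simp)
  intro z hz
  have hz' := mapsTo_diskMoebius ha hz
  have hzz := haff hz'
  rw [hslope] at hzz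
  have h3' : H 0 = 0 := h3
  simp only [h3', sub_zero, smul_eq_mul, mul_one, zero_add] at hzz
  simp only [hH, diskMoebius_neg_diskMoebius ha hz] at hzz
  exact hinj (hm hz) hz hzz

end Moebius

/-! ### Orbits of the semigroup and existence of the Kœnigs function. -/

section Flow

variable {F : ℝ → ℂ → ℂ} {f : ℂ → ℂ}

theorem IsHolSemigroup.continuousOn_orbit (hF : IsHolSemigroup F) {z : ℂ} (hz : z ∈ unitDisk) :
    ContinuousOn (fun t => F t z) (Ici 0) :=
  hF.continuous.comp (f := fun t : ℝ => (t, z)) (by fun_prop) fun _ ht => ⟨ht, hz⟩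

theorem IsSemigroupGenerator.hasDerivWithinAt_zero (hF : IsHolSemigroup F)
    (hf : IsSemigroupGenerator F f) {z : ℂ} (hz : z ∈ unitDisk) :
    HasDerivWithinAt (fun t => F t z) (f z) (Ici 0) 0 := by
  rw [← hasDerivWithinAt_Ioi_iff_Ici, hasDerivWithinAt_iff_tendsto_slope' (by simp)]
  refine (hf.tendsto z hz).congr fun t => ?_
  rw [slope_def_module, hF.zero z hz, sub_zero, ← Complex.coe_smul, smul_eq_mul,
    Complex.ofReal_inv, div_eq_inv_mul]

/-- The semigroup law moves the derivative at time `0` to time `t`. Only a right derivative results,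
which is enough for the uniqueness and constancy arguments below. -/
theorem IsSemigroupGenerator.hasDerivWithinAt_orbit (hF : IsHolSemigroup F)
    (hf : IsSemigroupGenerator F f) {z : ℂ} (hz : z ∈ unitDisk) {t : ℝ} (ht : 0 ≤ t) :
    HasDerivWithinAt (fun s => F s z) (f (F t z)) (Ici t) t := by
  have h0 := hf.hasDerivWithinAt_zero hF (hF.mapsTo t ht hz)
  have h1 : HasDerivWithinAt (fun s : ℝ => s - t) 1 (Ici t) t :=
    ((hasDerivAt_id t).sub_const t).hasDerivWithinAt
  have h2 := h0.scomp_of_eq t h1 (fun s hs => mem_Ici.mpr (sub_nonneg.mpr hs)) (sub_self t).symm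
  rw [one_smul] at h2
  refine h2.congr (fun s hs => ?_) ?_
  · simp only [Function.comp]
    rw [← hF.add _ _ (sub_nonneg.mpr hs) ht z hz, sub_add_cancel]
  · simp only [Function.comp]
    rw [← hF.add _ _ (sub_self t).ge ht z hz, sub_add_cancel]

theorem sub_mul_dslope_of_eq_zero {z₀ : ℂ} (hf0 : f z₀ = 0) (w : ℂ) :
    (w - z₀) * dslope f z₀ w = f w := by
  have := sub_smul_dslope f z₀ w
  rwa [hf0, sub_zero, smul_eq_mul] at this

/-- Grönwall: `f(w) = (w - z₀) g(w)` with `g` bounded along a compact orbit segment, so `F_s(z₀) -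
z₀` satisfies a linear differential inequality and starts at `0`. -/
theorem IsSemigroupGenerator.fixed_of_zero (hF : IsHolSemigroup F)
    (hf : IsSemigroupGenerator F f) {z₀ : ℂ} (hz₀ : z₀ ∈ unitDisk) (hf0 : f z₀ = 0)
    {t : ℝ} (ht : 0 ≤ t) : F t z₀ = z₀ := by
  have hc : ContinuousOn (fun s => F s z₀) (Icc 0 t) :=
    (hF.continuousOn_orbit hz₀).mono Icc_subset_Ici_self
  have hg : ContinuousOn (dslope f z₀) unitDisk :=
    ((Complex.differentiableOn_dslope (Metric.isOpen_ball.mem_nhds hz₀)).mpr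
      hf.holomorphic).continuousOn
  obtain ⟨K, hK⟩ := isCompact_Icc.exists_bound_of_continuousOn
    (hg.comp hc fun s hs => hF.mapsTo s hs.1 hz₀)
  have := eq_zero_of_abs_deriv_le_mul_abs_self_of_eq_zero_right (f := fun s => F s z₀ - z₀)
    (f' := fun s => f (F s z₀)) (K := K) (hc.sub continuousOn_const)
    (fun s hs => (hf.hasDerivWithinAt_orbit hF hz₀ hs.1).sub_const z₀)
    (by simp [hF.zero z₀ hz₀])
    (fun s hs => by
      rw [← sub_mul_dslope_of_eq_zero hf0, norm_mul, mul_comm]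
      exact mul_le_mul_of_nonneg_right (hK s (Ico_subset_Icc_self hs)) (norm_nonneg _))
    t (right_mem_Icc.mpr ht)
  exact sub_eq_zero.mp this

/-- A second zero would be a second common fixed point, making every `F_t` the identity and `f`
zero. -/
theorem IsSemigroupGenerator.ne_zero_of_ne (hF : IsHolSemigroup F)
    (hf : IsSemigroupGenerator F f) {z₀ : ℂ} (hz₀ : z₀ ∈ unitDisk) (hf0 : f z₀ = 0)
    (hd : deriv f z₀ ≠ 0) {z : ℂ} (hz : z ∈ unitDisk) (hne : z ≠ z₀) : f z ≠ 0 := by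
  intro hfz
  have hid : ∀ t, 0 ≤ t → EqOn (F t) id unitDisk := fun t ht =>
    eqOn_id_of_two_fixed hz₀ hz hne (hF.holomorphic t ht) (hF.mapsTo t ht)
      (hf.fixed_of_zero hF hz₀ hf0 ht) (hf.fixed_of_zero hF hz hfz ht)
  have hzero : ∀ w ∈ unitDisk, f w = 0 := fun w hw => by
    refine tendsto_nhds_unique (hf.tendsto w hw) ?_
    refine tendsto_const_nhds.congr' ?_
    filter_upwards [self_mem_nhdsWithin] with t ht
    rw [hid t (le_of_lt ht) hw, id, sub_self, zero_div]
  apply hd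
  have : f =ᶠ[𝓝 z₀] fun _ => 0 := by
    filter_upwards [Metric.isOpen_ball.mem_nhds hz₀] with w hw using hzero w hw
  rw [this.deriv_eq, deriv_const]

/-- Orbits of a semigroup with an interior fixed point are relatively compact in the disk. -/
theorem IsHolSemigroup.exists_compact_orbit (hF : IsHolSemigroup F) {z₀ z : ℂ}
    (hz₀ : z₀ ∈ unitDisk) (hz : z ∈ unitDisk) (hfix : ∀ t, 0 ≤ t → F t z₀ = z₀) :
    ∃ K : Set ℂ, IsCompact K ∧ K ⊆ unitDisk ∧ ∀ t, 0 ≤ t → F t z ∈ K := by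
  set r := ‖diskMoebius z₀ z‖ with hr
  have hr1 : r < 1 := mem_unitDisk.mp (mapsTo_diskMoebius hz₀ hz)
  have hsub : Metric.closedBall (0 : ℂ) r ⊆ unitDisk := Metric.closedBall_subset_ball hr1
  have hz₀' := neg_mem_unitDisk hz₀
  refine ⟨diskMoebius (-z₀) '' Metric.closedBall 0 r,
    (isCompact_closedBall _ _).image_of_continuousOn
      ((differentiableOn_diskMoebius hz₀').continuousOn.mono hsub), ?_, fun t ht => ?_⟩
  · rintro _ ⟨w, hw, rfl⟩
    exact mapsTo_diskMoebius hz₀' (hsub hw)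
  · refine ⟨diskMoebius z₀ (F t z), ?_, diskMoebius_neg_diskMoebius hz₀ (hF.mapsTo t ht hz)⟩
    rw [mem_closedBall_zero_iff]
    exact norm_diskMoebius_apply_le hz₀ hz (hF.holomorphic t ht) (hF.mapsTo t ht) (hfix t ht)

theorem tendsto_exp_neg_mul {lam : ℂ} (hre : 0 < lam.re) :
    Tendsto (fun t : ℝ => Complex.exp (-lam * t)) atTop (𝓝 0) := by
  rw [tendsto_zero_iff_norm_tendsto_zero]
  have : ∀ t : ℝ, ‖Complex.exp (-lam * t)‖ = Real.exp (-(lam.re * t)) := fun t => by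
    rw [Complex.norm_exp]; simp
  simp only [this]
  exact Real.tendsto_exp_neg_atTop_nhds_zero.comp (tendsto_id.const_mul_atTop hre)

/-- A solution of `h' f = -lam h` satisfies the Schroeder equation. -/
theorem IsSemigroupGenerator.schroeder_of_hasDerivAt (hF : IsHolSemigroup F)
    (hf : IsSemigroupGenerator F f) {lam : ℂ} {h h' : ℂ → ℂ}
    (hh : ∀ z ∈ unitDisk, HasDerivAt h (h' z) z) (heq : ∀ z ∈ unitDisk, h' z * f z = -lam * h z)
    {t : ℝ} (ht : 0 ≤ t) {z : ℂ} (hz : z ∈ unitDisk) :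
    h (F t z) = Complex.exp (-lam * t) * h z := by
  have hE : ∀ s : ℝ, HasDerivAt (fun s : ℝ => Complex.exp (lam * s))
      (Complex.exp (lam * s) * lam) s := fun s => by
    have h1 : HasDerivAt (fun s : ℝ => lam * (s : ℂ)) lam s := by
      simpa using (Complex.ofRealCLM.hasDerivAt (x := s)).const_mul lam
    exact h1.cexp
  have hcont : ContinuousOn h unitDisk := fun w hw => (hh w hw).continuousAt.continuousWithinAt
  -- Along an orbit, `e^{λs} h(F_s z)` has zero right derivative.
  have hconst := constant_of_has_deriv_right_zero (a := 0) (b := t)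
    (f := fun s : ℝ => Complex.exp (lam * s) * h (F s z))
    (ContinuousOn.mul (fun s _ => (hE s).continuousAt.continuousWithinAt)
      (hcont.comp ((hF.continuousOn_orbit hz).mono Icc_subset_Ici_self)
        fun s hs => hF.mapsTo s hs.1 hz))
    (fun s hs => by
      have hw := hF.mapsTo s hs.1 hz
      have h1 := (hh _ hw).comp_hasDerivWithinAt s (hf.hasDerivWithinAt_orbit hF hz hs.1)
      have h2 := (hE s).hasDerivWithinAt.mul h1
      refine h2.congr_deriv ?_
      simp only [Function.comp]
      rw [heq _ hw]
      ring)
    t (right_mem_Icc.mpr ht)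
  simp only [Complex.ofReal_zero, mul_zero, Complex.exp_zero, one_mul, hF.zero z hz] at hconst
  rw [← hconst, ← mul_assoc, ← Complex.exp_add]
  simp

theorem hasStrictDerivAt_of_mem_unitDisk {h : ℂ → ℂ} (hd : DifferentiableOn ℂ h unitDisk)
    {z : ℂ} (hz : z ∈ unitDisk) : HasStrictDerivAt h (deriv h z) z :=
  (hd.analyticAt (Metric.isOpen_ball.mem_nhds hz)).hasStrictDerivAt

/-- A locally univalent solution of the Schroeder equation is univalent if all orbits converge to
a common point of the disk. -/
theorem IsHolSemigroup.injOn_of_schroeder (hF : IsHolSemigroup F) {z₀ lam : ℂ}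
    (hz₀ : z₀ ∈ unitDisk) {h : ℂ → ℂ} (hd : DifferentiableOn ℂ h unitDisk)
    (hne : ∀ z ∈ unitDisk, deriv h z ≠ 0)
    (hs : ∀ t : ℝ, 0 ≤ t → ∀ z ∈ unitDisk, h (F t z) = Complex.exp (-lam * t) * h z)
    (hlim : ∀ z ∈ unitDisk, Tendsto (fun t => F t z) atTop (𝓝 z₀)) : InjOn h unitDisk := by
  intro z hz w hw hzw
  have hloc : ∀ p ∈ unitDisk, ∃ g : ℂ → ℂ, ∀ᶠ x in 𝓝 p, g (h x) = x := fun p hp =>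
    ⟨_, HasStrictFDerivAt.eventually_left_inverse
      ((hasStrictDerivAt_of_mem_unitDisk hd hp).hasStrictFDerivAt_equiv (hne p hp))⟩
  have heq : ∀ t : ℝ, 0 ≤ t → h (F t z) = h (F t w) := fun t ht => by
    rw [hs t ht z hz, hs t ht w hw, hzw]
  -- The times at which the two orbits coincide form a closed set, nonempty because `h` is injective
  -- near `z₀`. If its least element were positive, local injectivity of `h` at the meeting point
  -- would give earlier coincidences.
  set S : Set ℝ := {t | t ∈ Ici 0 ∧ F t z = F t w} with hS
  have hclosed : IsClosed S := by
    have := ((hF.continuousOn_orbit hz).sub (hF.continuousOn_orbit hw)).preimage_isClosed_of_isClosed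
      isClosed_Ici (isClosed_singleton (x := (0 : ℂ)))
    convert this using 1
    ext t
    simp [hS, sub_eq_zero]
  have hnonempty : S.Nonempty := by
    obtain ⟨g, hg⟩ := hloc z₀ hz₀
    obtain ⟨t, ⟨h1, h2⟩, h3⟩ := (((hlim z hz).eventually hg).and ((hlim w hw).eventually hg)).and
      (eventually_ge_atTop 0) |>.exists
    exact ⟨t, h3, by rw [← h1, ← h2, heq t h3]⟩
  have hbdd : BddBelow S := ⟨0, fun t ht => ht.1⟩
  obtain ⟨hT0, hT⟩ := hclosed.csInf_mem hnonempty hbdd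
  set T := sInf S
  rcases (mem_Ici.mp hT0).eq_or_lt with h0 | hpos
  · rw [← h0, hF.zero z hz, hF.zero w hw] at hT
    exact hT
  · exfalso
    obtain ⟨g, hg⟩ := hloc (F T z) (hF.mapsTo T hT0 hz)
    have hcz : ContinuousAt (fun t => F t z) T :=
      (hF.continuousOn_orbit hz).continuousAt (Ici_mem_nhds hpos)
    have hcw : ContinuousAt (fun t => F t w) T :=
      (hF.continuousOn_orbit hw).continuousAt (Ici_mem_nhds hpos)
    have h1 := hcz.eventually hg
    have h2 := hcw.eventually (p := fun x => g (h x) = x) (by simpa only [hT] using hg)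
    have h3 : ∀ᶠ t in 𝓝 T, t ∈ S := by
      filter_upwards [h1, h2, Ici_mem_nhds hpos] with t a b c
      exact ⟨c, by rw [← a, ← b, heq t c]⟩
    obtain ⟨t, ht, htS⟩ := (h3.filter_mono (nhdsWithin_le_nhds (s := Iio T))).and
      self_mem_nhdsWithin |>.exists
    exact absurd (csInf_le hbdd ht) (not_le.mpr htS)

/-- Existence of the Koenigs function. -/
theorem IsSemigroupGenerator.exists_isKoenigsFunction (hF : IsHolSemigroup F)
    (hf : IsSemigroupGenerator F f) {z₀ : ℂ} (hz₀ : z₀ ∈ unitDisk) (hf0 : f z₀ = 0) {lam : ℂ}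
    (hlam : lam = -deriv f z₀) (hre : 0 < lam.re) :
    ∃ h : ℂ → ℂ, IsKoenigsFunction F z₀ lam h := by
  have hl0 : lam ≠ 0 := fun h => by simp [h] at hre
  have hd0 : deriv f z₀ ≠ 0 := fun h => hl0 (by rw [hlam, h, neg_zero])
  have hnhds : unitDisk ∈ 𝓝 z₀ := Metric.isOpen_ball.mem_nhds hz₀
  set g := dslope f z₀ with hg
  have hgd : DifferentiableOn ℂ g unitDisk :=
    (Complex.differentiableOn_dslope hnhds).mpr hf.holomorphic
  have hfg : ∀ w, (w - z₀) * g w = f w := sub_mul_dslope_of_eq_zero hf0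
  have hg0 : g z₀ = -lam := by rw [hg, dslope_same, hlam, neg_neg]
  have hgne : ∀ z ∈ unitDisk, g z ≠ 0 := fun z hz h => by
    rcases eq_or_ne z z₀ with rfl | hne
    · rw [hg0] at h; exact hl0 (neg_eq_zero.mp h)
    · exact hf.ne_zero_of_ne hF hz₀ hf0 hd0 hz hne (by rw [← hfg, h, mul_zero])
  -- The equation reads `h'/h = k/(z - z₀)`. As `k(z₀) = 1`, splitting off the simple pole leaves `q
  -- = (k - 1)/(z - z₀)`, whence `h = (z - z₀) e^p` with `p' = q`; `p(z₀) = 0` gives `h'(z₀) = 1`.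
  set k : ℂ → ℂ := fun z => -lam / g z with hk
  have hkd : DifferentiableOn ℂ k unitDisk := (differentiableOn_const _).div hgd hgne
  have hk0 : k z₀ = 1 := by rw [hk]; simp only [hg0]; exact div_self (neg_ne_zero.mpr hl0)
  set q := dslope k z₀ with hq
  have hqd : DifferentiableOn ℂ q unitDisk := (Complex.differentiableOn_dslope hnhds).mpr hkd
  have hkq : ∀ z, (z - z₀) * q z = k z - 1 := fun z => by
    have := sub_smul_dslope k z₀ z
    rwa [hk0, smul_eq_mul] at this
  obtain ⟨p, hp0, hp⟩ := hqd.isExactOn_ball.with_val_at z₀ 0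
  set h : ℂ → ℂ := fun z => (z - z₀) * Complex.exp (p z) with hh
  have hder : ∀ z ∈ unitDisk, HasDerivAt h (Complex.exp (p z) * k z) z := fun z hz => by
    refine (((hasDerivAt_id z).sub_const z₀).mul (hp z hz).cexp).congr_deriv ?_
    have := hkq z
    simp only [id]
    linear_combination Complex.exp (p z) * this
  have hdiff : DifferentiableOn ℂ h unitDisk := fun z hz =>
    (hder z hz).differentiableAt.differentiableWithinAt
  have hode : ∀ z ∈ unitDisk, Complex.exp (p z) * k z * f z = -lam * h z := fun z hz => by
    have hgz := hgne z hz
    rw [← hfg z]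
    simp only [hk, hh]
    field_simp
  have hs : ∀ t : ℝ, 0 ≤ t → ∀ z ∈ unitDisk, h (F t z) = Complex.exp (-lam * t) * h z :=
    fun t ht z hz => hf.schroeder_of_hasDerivAt hF hder hode ht hz
  -- The orbit stays in a compact subset of the disk, and `h` vanishes at each cluster point because
  -- `h(F_t z) → 0`; the only zero of `h` is `z₀`.
  have hlim : ∀ z ∈ unitDisk, Tendsto (fun t => F t z) atTop (𝓝 z₀) := fun z hz => by
    obtain ⟨K, hK, hKD, hKm⟩ := hF.exists_compact_orbit hz₀ hz
      fun t ht => hf.fixed_of_zero hF hz₀ hf0 ht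
    refine hK.tendsto_nhds_of_unique_mapClusterPt
      ((eventually_ge_atTop 0).mono hKm) fun y hy hcl => ?_
    have h1 : MapClusterPt (h y) atTop (h ∘ fun t => F t z) :=
      hcl.continuousAt_comp (hder y (hKD hy)).continuousAt
    have h2 : Tendsto (h ∘ fun t => F t z) atTop (𝓝 0) := by
      have := (tendsto_exp_neg_mul hre).mul_const (h z)
      rw [zero_mul] at this
      refine this.congr' ?_
      filter_upwards [eventually_ge_atTop 0] with t ht using (hs t ht z hz).symm
    have h3 : h y = 0 := by
      by_contra hne
      exact (disjoint_nhds_nhds.mpr hne).le_bot.not_gt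
        (lt_of_lt_of_le (bot_lt_iff_ne_bot.mpr h1.neBot.ne)
          (inf_le_inf_left _ h2))
    rcases mul_eq_zero.mp h3 with h4 | h4
    · exact sub_eq_zero.mp h4
    · exact absurd h4 (Complex.exp_ne_zero _)
  refine ⟨h, hdiff, ?_, hs, by simp [hh], ?_⟩
  · refine hF.injOn_of_schroeder hz₀ hdiff (fun z hz => ?_) hs hlim
    rw [(hder z hz).deriv]
    exact mul_ne_zero (Complex.exp_ne_zero _) (div_ne_zero (neg_ne_zero.mpr hl0) (hgne z hz))
  · rw [(hder z₀ hz₀).deriv, hk0, hp0, Complex.exp_zero, mul_one]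

end Flow

/-! ### The Kœnigs function as a coordinate. -/

section KoenigsFunction

variable {F : ℝ → ℂ → ℂ} {f h : ℂ → ℂ} {z₀ lam : ℂ}

theorem IsKoenigsFunction.hasDerivAt (hh : IsKoenigsFunction F z₀ lam h) {z : ℂ}
    (hz : z ∈ unitDisk) : HasDerivAt h (deriv h z) z :=
  (hasStrictDerivAt_of_mem_unitDisk hh.holomorphic hz).hasDerivAt

theorem IsKoenigsFunction.deriv_mul_generator (hh : IsKoenigsFunction F z₀ lam h)
    (hF : IsHolSemigroup F) (hf : IsSemigroupGenerator F f) {z : ℂ} (hz : z ∈ unitDisk) :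
    deriv h z * f z = -lam * h z := by
  have h1 : HasDerivWithinAt (fun t : ℝ => h (F t z)) (deriv h z * f z) (Ici 0) 0 :=
    HasDerivAt.comp_hasDerivWithinAt_of_eq 0 (hh.hasDerivAt hz)
      (hf.hasDerivWithinAt_zero hF hz) (hF.zero z hz).symm
  have h2 : HasDerivAt (fun t : ℝ => Complex.exp (-lam * t) * h z) (-lam * h z) 0 := by
    have h3 : HasDerivAt (fun s : ℝ => -lam * (s : ℂ)) (-lam) 0 := by
      simpa using (Complex.ofRealCLM.hasDerivAt (x := (0 : ℝ))).const_mul (-lam)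
    simpa using h3.cexp.mul_const (h z)
  have h4 : HasDerivWithinAt (fun t : ℝ => h (F t z)) (-lam * h z) (Ici 0) 0 :=
    h2.hasDerivWithinAt.congr (fun t ht => hh.schroeder t ht z hz)
      (hh.schroeder 0 le_rfl z hz)
  exact (uniqueDiffWithinAt_Ici 0).eq_deriv _ h1 h4

/-- By `h' f = -λ h`, a critical point is a zero of `h`, hence equals `z₀`, where `h' = 1`. -/
theorem IsKoenigsFunction.deriv_ne_zero (hh : IsKoenigsFunction F z₀ lam h)
    (hF : IsHolSemigroup F) (hf : IsSemigroupGenerator F f) (hz₀ : z₀ ∈ unitDisk)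
    (hlam : lam ≠ 0) {z : ℂ} (hz : z ∈ unitDisk) : deriv h z ≠ 0 := by
  intro h0
  have h1 := hh.deriv_mul_generator hF hf hz
  rw [h0, zero_mul] at h1
  have h2 : h z = 0 := (mul_eq_zero.mp h1.symm).resolve_left (neg_ne_zero.mpr hlam)
  have h3 : z = z₀ := hh.univalent hz hz₀ (by rw [h2, hh.map_fixed])
  rw [h3, hh.deriv_fixed] at h0
  exact one_ne_zero h0

theorem IsKoenigsFunction.invFunOn_apply (hh : IsKoenigsFunction F z₀ lam h) {z : ℂ}
    (hz : z ∈ unitDisk) : Function.invFunOn h unitDisk (h z) = z :=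
  hh.univalent.leftInvOn_invFunOn hz

theorem IsKoenigsFunction.hasDerivAt_invFunOn (hh : IsKoenigsFunction F z₀ lam h) {z : ℂ}
    (hz : z ∈ unitDisk) (hne : deriv h z ≠ 0) :
    HasDerivAt (Function.invFunOn h unitDisk) (deriv h z)⁻¹ (h z) := by
  refine ((hasStrictDerivAt_of_mem_unitDisk hh.holomorphic hz).to_local_left_inverse hne
    ?_).hasDerivAt
  filter_upwards [Metric.isOpen_ball.mem_nhds hz] with x hx using hh.invFunOn_apply hx

/-- `Function.invFunOn` inverts `h` only on `h(𝔻)`; this ensures that its germ at `0` is the true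
inverse. -/
theorem IsKoenigsFunction.image_mem_nhds (hh : IsKoenigsFunction F z₀ lam h)
    (hz₀ : z₀ ∈ unitDisk) : h '' unitDisk ∈ 𝓝 0 := by
  have hs := hasStrictDerivAt_of_mem_unitDisk hh.holomorphic hz₀
  have := hs.map_nhds_eq (by rw [hh.deriv_fixed]; exact one_ne_zero)
  rw [hh.map_fixed] at this
  rw [← this]
  exact image_mem_map (Metric.isOpen_ball.mem_nhds hz₀)

theorem IsKoenigsFunction.tendsto_apply_flow (hh : IsKoenigsFunction F z₀ lam h)
    (hre : 0 < lam.re) {z : ℂ} (hz : z ∈ unitDisk) :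
    Tendsto (fun t => h (F t z)) atTop (𝓝 0) := by
  have := (tendsto_exp_neg_mul hre).mul_const (h z)
  rw [zero_mul] at this
  refine this.congr' ?_
  filter_upwards [eventually_ge_atTop 0] with t ht using (hh.schroeder t ht z hz).symm

theorem IsKoenigsFunction.norm_apply_flow_le (hh : IsKoenigsFunction F z₀ lam h)
    (hre : 0 < lam.re) {z : ℂ} (hz : z ∈ unitDisk) {t : ℝ} (ht : 0 ≤ t) :
    ‖h (F t z)‖ ≤ ‖h z‖ := by
  rw [hh.schroeder t ht z hz, norm_mul, Complex.norm_exp]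
  refine mul_le_of_le_one_left (norm_nonneg _) (Real.exp_le_one_iff.mpr ?_)
  simpa using mul_nonneg hre.le ht

variable {A : Type*} [NormedRing A] [NormedAlgebra ℂ A]

theorem IsKoenigsFunction.hasDerivAt_comp_invFunOn (hh : IsKoenigsFunction F z₀ lam h)
    {u : ℂ → A} (hu : DifferentiableOn ℂ u unitDisk) {z : ℂ} (hz : z ∈ unitDisk)
    (hne : deriv h z ≠ 0) :
    HasDerivAt (fun w => u (Function.invFunOn h unitDisk w)) ((deriv h z)⁻¹ • deriv u z) (h z) :=
  HasDerivAt.scomp_of_eq (h z)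
    (hu.differentiableAt (Metric.isOpen_ball.mem_nhds hz)).hasDerivAt
    (hh.hasDerivAt_invFunOn hz hne) (hh.invFunOn_apply hz).symm

theorem IsKoenigsFunction.analyticAt_comp_invFunOn [CompleteSpace A]
    (hh : IsKoenigsFunction F z₀ lam h) (hz₀ : z₀ ∈ unitDisk)
    (hne : ∀ z ∈ unitDisk, deriv h z ≠ 0) {u : ℂ → A} (hu : DifferentiableOn ℂ u unitDisk) :
    AnalyticAt ℂ (fun w => u (Function.invFunOn h unitDisk w)) 0 := by
  rw [Complex.analyticAt_iff_eventually_differentiableAt]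
  filter_upwards [hh.image_mem_nhds hz₀]
  rintro _ ⟨z, hz, rfl⟩
  exact (hh.hasDerivAt_comp_invFunOn hu hz (hne z hz)).differentiableAt

end KoenigsFunction

/-! ### The one-parameter group generated by `C`. -/

section ExpGroup

variable {A : Type*} [NormedRing A] [NormedAlgebra ℂ A]

/-- The one-parameter group `t ↦ e^{tC}`. -/
def expGroup (C : A) (t : ℝ) : A := NormedSpace.exp ((t : ℂ) • C)

theorem expGroup_add [CompleteSpace A] (C : A) (s t : ℝ) :
    expGroup C (s + t) = expGroup C s * expGroup C t := by
  let _ : NormedAlgebra ℚ A := NormedAlgebra.restrictScalars ℚ ℂ A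
  rw [expGroup, Complex.ofReal_add, add_smul]
  exact NormedSpace.exp_add_of_commute (((Commute.refl C).smul_left _).smul_right _)

theorem expGroup_zero (C : A) : expGroup C 0 = 1 := by
  simp [expGroup]

theorem expGroup_mul_neg [CompleteSpace A] (C : A) (t : ℝ) : expGroup C t * expGroup C (-t) = 1 := by
  rw [← expGroup_add, add_neg_cancel, expGroup_zero]

theorem isUnit_expGroup [CompleteSpace A] (C : A) (t : ℝ) : IsUnit (expGroup C t) := by
  let _ : NormedAlgebra ℚ A := NormedAlgebra.restrictScalars ℚ ℂ A
  exact NormedSpace.isUnit_exp _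

theorem hasDerivAt_expGroup [CompleteSpace A] (C : A) (t : ℝ) :
    HasDerivAt (expGroup C) (expGroup C t * C) t := by
  have h := (hasDerivAt_exp_smul_const C (t : ℂ)).scomp t (Complex.ofRealCLM.hasDerivAt (x := t))
  rwa [Complex.ofRealCLM_apply, Complex.ofReal_one, one_smul] at h

end ExpGroup

/-! ### Linearization of semicocycles. -/

section Semicocycle

variable {A : Type*} [NormedRing A] [NormedAlgebra ℂ A] {F : ℝ → ℂ → ℂ} {f : ℂ → ℂ}
  {Γ : ℝ → ℂ → A} {B : ℂ → A}

/-- Uniform continuity on a compact orbit segment puts `Γ_s(F_τ z)` within distance `1` of the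
identity for all small `s`, uniformly in `τ`; the chain rule factors `Γ_t(z)` into such invertible
elements. -/
theorem IsSemicocycle.isUnit [CompleteSpace A] (hF : IsHolSemigroup F) (hΓ : IsSemicocycle F Γ)
    {t : ℝ} (ht : 0 ≤ t) {z : ℂ} (hz : z ∈ unitDisk) : IsUnit (Γ t z) := by
  have hcont : ContinuousOn (fun p : ℝ × ℝ => Γ p.1 (F p.2 z)) (Icc 0 1 ×ˢ Icc 0 t) := by
    refine hΓ.continuous.comp (f := fun p : ℝ × ℝ => (p.1, F p.2 z))
      (continuousOn_fst.prodMk ((hF.continuousOn_orbit hz).comp continuousOn_snd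
        fun p hp => hp.2.1)) fun p hp => ⟨hp.1.1, hF.mapsTo _ hp.2.1 hz⟩
  have hunif := (isCompact_Icc.prod isCompact_Icc).uniformContinuousOn_of_continuous hcont
  obtain ⟨δ, hδ, hδ'⟩ := Metric.uniformContinuousOn_iff.mp hunif 1 one_pos
  set ε := min (δ / 2) 1 with hε
  have hε0 : 0 < ε := by positivity
  have hsmall : ∀ s ∈ Icc 0 ε, ∀ τ ∈ Icc 0 t, IsUnit (Γ s (F τ z)) := fun s hs τ hτ => by
    have h1 := hδ' (0, τ) ⟨⟨le_rfl, zero_le_one⟩, hτ⟩ (s, τ)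
      ⟨⟨hs.1, hs.2.trans (min_le_right _ _)⟩, hτ⟩ (by
        rw [Prod.dist_eq, dist_self, max_eq_left dist_nonneg, Real.dist_eq, zero_sub, abs_neg,
          abs_of_nonneg hs.1]
        exact (hs.2.trans (min_le_left _ _)).trans_lt (by linarith))
    simp only [hΓ.zero _ (hF.mapsTo τ hτ.1 hz), dist_eq_norm] at h1
    have := isUnit_one_sub_of_norm_lt_one h1
    rwa [sub_sub_cancel] at this
  have hind : ∀ n : ℕ, ∀ s ∈ Icc 0 t, s ≤ n * ε → IsUnit (Γ s z) := fun n => by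
    induction n with
    | zero =>
      intro s hs hsn
      have : s = 0 := le_antisymm (by simpa using hsn) hs.1
      rw [this, hΓ.zero z hz]
      exact isUnit_one
    | succ n ih =>
      intro s hs hsn
      rcases le_total s ε with hle | hle
      · have := hsmall s ⟨hs.1, hle⟩ 0 ⟨le_rfl, ht⟩
        rwa [hF.zero z hz] at this
      · have h1 : s - ε ∈ Icc 0 t := ⟨sub_nonneg.mpr hle, by linarith [hs.2]⟩
        have h2 := hΓ.chain ε (s - ε) hε0.le h1.1 z hz
        rw [add_sub_cancel] at h2
        rw [← h2]
        refine (hsmall ε ⟨hε0.le, le_rfl⟩ _ h1).mul (ih _ h1 ?_)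
        push_cast at hsn
        linarith
  obtain ⟨n, hn⟩ := exists_nat_ge (t / ε)
  exact hind n t ⟨ht, le_rfl⟩ ((div_le_iff₀ hε0).mp hn)

/-- If `f M' + M B = C M` on a forward invariant set, then `M(F_t) Γ_t = e^{tC} M` there. -/
theorem IsSemicocycleGeneratedBy.intertwine [CompleteSpace A] (hF : IsHolSemigroup F)
    (hf : IsSemigroupGenerator F f) (hΓB : IsSemicocycleGeneratedBy F Γ B) {V : Set ℂ}
    (hV : V ⊆ unitDisk) (hVF : ∀ t, 0 ≤ t → MapsTo (F t) V V) {C : A} {M M' : ℂ → A}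
    (hM : ∀ z ∈ V, HasDerivAt M (M' z) z)
    (heq : ∀ z ∈ V, f z • M' z + M z * B z = C * M z) {t : ℝ} (ht : 0 ≤ t) {z : ℂ} (hz : z ∈ V) :
    M (F t z) * Γ t z = expGroup C t * M z := by
  have hzD := hV hz
  have hcM : ContinuousOn M V := fun w hw => (hM w hw).continuousAt.continuousWithinAt
  have hneg : ∀ s : ℝ, HasDerivAt (fun s => expGroup C (-s)) (-(expGroup C (-s) * C)) s :=
    fun s => by
      have := (hasDerivAt_expGroup C (-s)).scomp s (hasDerivAt_neg s)
      rwa [neg_one_smul] at this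
  have hcΓ : ContinuousOn (fun s => Γ s z) (Icc 0 t) := fun s hs =>
    ((hΓB z hzD).2 s hs.1).continuousWithinAt.mono Icc_subset_Ici_self
  have hconst := constant_of_has_deriv_right_zero (a := 0) (b := t)
    (f := fun s : ℝ => expGroup C (-s) * (M (F s z) * Γ s z))
    (ContinuousOn.mul (fun s _ => (hneg s).continuousAt.continuousWithinAt)
      ((hcM.comp ((hF.continuousOn_orbit hzD).mono Icc_subset_Ici_self)
        fun s hs => hVF s hs.1 hz).mul hcΓ))
    (fun s hs => by
      have hw := hVF s hs.1 hz
      have h1 : HasDerivWithinAt (fun s => M (F s z)) (f (F s z) • M' (F s z)) (Ici s) s :=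
        (hM _ hw).scomp_hasDerivWithinAt s (hf.hasDerivWithinAt_orbit hF hzD hs.1)
      have h2 := ((hΓB z hzD).2 s hs.1).mono (Ici_subset_Ici.mpr hs.1)
      refine ((hneg s).hasDerivWithinAt.mul (h1.mul h2)).congr_deriv ?_
      have h3 : f (F s z) • M' (F s z) = C * M (F s z) - M (F s z) * B (F s z) :=
        eq_sub_of_add_eq (heq _ hw)
      rw [h3, Pi.mul_apply]
      noncomm_ring)
    t (right_mem_Icc.mpr ht)
  simp only [neg_zero, expGroup_zero, one_mul, hF.zero z hzD, (hΓB z hzD).1, mul_one] at hconst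
  rw [← hconst, ← mul_assoc, expGroup_mul_neg, one_mul]

/-- The differential equation satisfied by a linearizing map. -/
theorem IsSemicocycleGeneratedBy.linearizing_ode [CompleteSpace A] (hF : IsHolSemigroup F)
    (hf : IsSemigroupGenerator F f) (hΓB : IsSemicocycleGeneratedBy F Γ B) {C : A} {M : ℂ → A}
    (hM : DifferentiableOn ℂ M unitDisk)
    (heq : ∀ t : ℝ, 0 ≤ t → ∀ z ∈ unitDisk, M (F t z) * Γ t z = expGroup C t * M z)
    {z : ℂ} (hz : z ∈ unitDisk) : f z • deriv M z + M z * B z = C * M z := by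
  have hMz := (hM.differentiableAt (Metric.isOpen_ball.mem_nhds hz)).hasDerivAt
  have h1 : HasDerivWithinAt (fun s => M (F s z)) (f z • deriv M z) (Ici 0) 0 :=
    HasDerivAt.scomp_hasDerivWithinAt_of_eq 0 hMz (hf.hasDerivWithinAt_zero hF hz)
      (hF.zero z hz).symm
  have h2 := h1.mul ((hΓB z hz).2 0 le_rfl)
  have h3 : HasDerivWithinAt (fun s => expGroup C s * M z) (C * M z) (Ici 0) 0 := by
    have := ((hasDerivAt_expGroup C 0).mul_const (M z)).hasDerivWithinAt (s := Ici 0)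
    rwa [expGroup_zero, one_mul] at this
  have h4 := h3.congr (fun t ht => heq t ht z hz) (heq 0 le_rfl z hz)
  have h5 := (uniqueDiffWithinAt_Ici (0 : ℝ)).eq_deriv _ h2 h4
  rwa [hF.zero z hz, (hΓB z hz).1, mul_one, mul_one] at h5

variable {h : ℂ → ℂ} {z₀ lam : ℂ}

/-- At `z₀` the differential equation reads `M(z₀) B₀ = C M(z₀)`, so passing to `N = M(z₀)⁻¹ M`
replaces `C` by `B₀` and makes the constant coefficient `1`. -/
theorem recSolvable_of_isLinearizable [CompleteSpace A] (hF : IsHolSemigroup F)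
    (hf : IsSemigroupGenerator F f) (hz₀ : z₀ ∈ unitDisk) (hf0 : f z₀ = 0) (hlam : lam ≠ 0)
    (hB : DifferentiableOn ℂ B unitDisk) (hh : IsKoenigsFunction F z₀ lam h)
    (hΓB : IsSemicocycleGeneratedBy F Γ B) (hlin : IsLinearizable F Γ) :
    RecSolvable lam (B z₀) (koenigsCoeff B h) := by
  obtain ⟨C, M, hM, hMu, hMΓ⟩ := hlin
  have heq : ∀ t : ℝ, 0 ≤ t → ∀ z ∈ unitDisk, M (F t z) * Γ t z = expGroup C t * M z :=
    fun t ht z hz => by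
      rw [hMΓ t ht z hz, mul_assoc (Ring.inverse _), ← mul_assoc (M _),
        Ring.mul_inverse_cancel _ (hMu _ (hF.mapsTo t ht hz)), one_mul, expGroup]
  have hode : ∀ z ∈ unitDisk, f z • deriv M z + M z * B z = C * M z := fun z hz =>
    hΓB.linearizing_ode hF hf hM heq hz
  have hne : ∀ z ∈ unitDisk, deriv h z ≠ 0 := fun z hz => hh.deriv_ne_zero hF hf hz₀ hlam hz
  obtain ⟨U, hU⟩ := hMu z₀ hz₀
  have hU0 : (U : A) * B z₀ = C * U := by
    have := hode z₀ hz₀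
    rwa [hf0, zero_smul, zero_add, ← hU] at this
  have hUC : (↑U⁻¹ : A) * C = B z₀ * ↑U⁻¹ := by
    rw [Units.inv_mul_eq_iff_eq_mul, ← mul_assoc, hU0, mul_assoc, Units.mul_inv, mul_one]
  set N : ℂ → A := fun z => ↑U⁻¹ * M z with hN
  have hNd : DifferentiableOn ℂ N unitDisk := hM.const_mul _
  have hψ0 : Function.invFunOn h unitDisk 0 = z₀ := by
    rw [← hh.map_fixed, hh.invFunOn_apply hz₀]
  have hb0 : B z₀ = (fun w => B (Function.invFunOn h unitDisk w)) 0 := by simp only [hψ0]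
  rw [hb0]
  refine recSolvable_of_analyticAt_solution (n := fun w => N (Function.invFunOn h unitDisk w))
    (hh.analyticAt_comp_invFunOn hz₀ hne hB) (hh.analyticAt_comp_invFunOn hz₀ hne hNd)
    (by simp only [hψ0, hN, ← hU, Units.inv_mul]) ?_
  filter_upwards [hh.image_mem_nhds hz₀]
  rintro _ ⟨z, hz, rfl⟩
  have hdN : deriv N z = ↑U⁻¹ * deriv M z :=
    ((hM.differentiableAt (Metric.isOpen_ball.mem_nhds hz)).hasDerivAt.const_mul _).deriv
  -- Change of variable: `λ w d/dw` becomes `-f d/dz`.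
  have hscal : lam * h z * (deriv h z)⁻¹ = -f z := by
    have h1 := hh.deriv_mul_generator hF hf hz
    have h2 := hne z hz
    field_simp
    linear_combination h1
  rw [(hh.hasDerivAt_comp_invFunOn hNd hz (hne z hz)).deriv, smul_smul, smul_smul, hscal,
    hh.invFunOn_apply hz, hψ0, hdN]
  have h3 : f z • deriv M z = C * M z - M z * B z := eq_sub_of_add_eq (hode z hz)
  rw [neg_smul, ← mul_smul_comm, h3, mul_sub, ← mul_assoc, hUC]
  simp only [hN]
  noncomm_ring

theorem isLinearizable_of_recSolvable [CompleteSpace A] (hF : IsHolSemigroup F)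
    (hf : IsSemigroupGenerator F f) (hz₀ : z₀ ∈ unitDisk) (hre : 0 < lam.re)
    (hB : DifferentiableOn ℂ B unitDisk) (hh : IsKoenigsFunction F z₀ lam h)
    (hΓ : IsSemicocycle F Γ) (hΓB : IsSemicocycleGeneratedBy F Γ B)
    (hrec : RecSolvable lam (B z₀) (koenigsCoeff B h)) : IsLinearizable F Γ := by
  have hlam : lam ≠ 0 := fun h => by simp [h] at hre
  have hne : ∀ z ∈ unitDisk, deriv h z ≠ 0 := fun z hz => hh.deriv_ne_zero hF hf hz₀ hlam hz
  have hψ0 : Function.invFunOn h unitDisk 0 = z₀ := by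
    rw [← hh.map_fixed, hh.invFunOn_apply hz₀]
  obtain ⟨n, hn, hn0, hnode⟩ := exists_analyticAt_solution hlam
    (hh.analyticAt_comp_invFunOn hz₀ hne hB) (by
      rw [hψ0]
      exact hrec)
  have hnu : ∀ᶠ w in 𝓝 0, IsUnit (n w) :=
    hn.continuousAt.eventually (Units.isOpen.mem_nhds (by rw [hn0]; exact isUnit_one))
  obtain ⟨r, hr, hball⟩ := Metric.eventually_nhds_iff_ball.mp
    ((hn.eventually_analyticAt.and hnu).and hnode)
  set C := B z₀ with hC
  set V : Set ℂ := {z | z ∈ unitDisk ∧ h z ∈ Metric.ball 0 r} with hV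
  have hVF : ∀ t, 0 ≤ t → MapsTo (F t) V V := fun t ht z hz => by
    refine ⟨hF.mapsTo t ht hz.1, ?_⟩
    have := hz.2
    rw [mem_ball_zero_iff] at this ⊢
    exact (hh.norm_apply_flow_le hre hz.1 ht).trans_lt this
  have hloc : ∀ t, 0 ≤ t → ∀ z ∈ V, n (h (F t z)) * Γ t z = expGroup C t * n (h z) :=
    fun t ht z hz => by
      refine hΓB.intertwine hF hf (fun z hz => hz.1) hVF (M := fun z => n (h z))
        (M' := fun z => deriv h z • deriv n (h z)) (fun w hw => ?_) (fun w hw => ?_) ht hz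
      · exact (hball _ hw.2).1.1.differentiableAt.hasDerivAt.scomp w (hh.hasDerivAt hw.1)
      · have h1 := (hball _ hw.2).2
        simp only [hψ0, hh.invFunOn_apply hw.1] at h1
        rw [smul_smul, mul_comm, hh.deriv_mul_generator hF hf hw.1, neg_mul, neg_smul, mul_smul]
        rw [← sub_eq_zero, ← neg_eq_zero, ← h1]
        abel
  -- The value of `M(z)` as computed from time `t`. Two admissible times are compared through their
  -- sum.
  set P : ℝ → ℂ → A := fun t z => expGroup C (-t) * (n (h (F t z)) * Γ t z) with hP
  have hPadd : ∀ t s, 0 ≤ t → 0 ≤ s → ∀ z ∈ unitDisk, F t z ∈ V → P (s + t) z = P t z :=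
    fun t s ht hs z hz hV' => by
      simp only [hP]
      rw [hF.add s t hs ht z hz, ← hΓ.chain s t hs ht z hz, ← mul_assoc (n _), hloc s hs _ hV',
        mul_assoc, ← mul_assoc (expGroup C (-(s + t))), ← expGroup_add]
      congr 2
      ring
  have hex : ∀ z, z ∈ unitDisk → ∃ t, 0 ≤ t ∧ F t z ∈ V := fun z hz => by
    obtain ⟨t, h1, h2⟩ := ((hh.tendsto_apply_flow hre hz).eventually
      (Metric.ball_mem_nhds 0 hr)).and (eventually_ge_atTop 0) |>.exists
    exact ⟨t, h2, hF.mapsTo t h2 hz, h1⟩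
  choose! T hT0 hTV using hex
  have hM : ∀ z ∈ unitDisk, ∀ t, 0 ≤ t → F t z ∈ V → P (T z) z = P t z :=
    fun z hz t ht hV' => by
      rw [← hPadd t (T z) ht (hT0 z hz) z hz hV', add_comm,
        hPadd (T z) t (hT0 z hz) ht z hz (hTV z hz)]
  have hunit : ∀ z ∈ unitDisk, IsUnit (P (T z) z) := fun z hz =>
    (isUnit_expGroup C _).mul ((hball _ (hTV z hz).2).1.2.mul (hΓ.isUnit hF (hT0 z hz) hz))
  refine ⟨C, fun z => P (T z) z, fun z hz => ?_, hunit, fun s hs z hz => ?_⟩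
  · have ht := hT0 z hz
    have hFd := (hF.holomorphic _ ht).differentiableAt (Metric.isOpen_ball.mem_nhds hz)
    have hhd := (hh.hasDerivAt (hTV z hz).1).differentiableAt
    have hnd := (hball _ (hTV z hz).2).1.1.differentiableAt
    have hΓd := (hΓ.holomorphic _ ht).differentiableAt (Metric.isOpen_ball.mem_nhds hz)
    have hPd : DifferentiableAt ℂ (P (T z)) z :=
      (((hnd.comp _ hhd).comp z hFd).mul hΓd).const_mul _
    -- The choice `T` need not be continuous, but the fixed time `T z` is admissible for all points
    -- near `z`.
    refine (hPd.congr_of_eventuallyEq ?_).differentiableWithinAt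
    have hVn : ∀ᶠ w in 𝓝 z, h (F (T z) w) ∈ Metric.ball 0 r :=
      (hhd.comp z hFd).continuousAt.eventually (Metric.isOpen_ball.mem_nhds (hTV z hz).2)
    filter_upwards [hVn, Metric.isOpen_ball.mem_nhds hz] with w hw hwD
    exact hM w hwD _ ht ⟨hF.mapsTo _ ht hwD, hw⟩
  · have hw := hF.mapsTo s hs hz
    have ht := hT0 _ hw
    -- Evaluating `M(z)` at time `T (F s z) + s` makes it comparable with `M(F_s z)` at time `T (F s
    -- z)`.
    have hV' : F (T (F s z) + s) z ∈ V := by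
      rw [hF.add _ _ ht hs z hz]
      exact hTV _ hw
    have key : P (T (F s z)) (F s z) * Γ s z = expGroup C s * P (T z) z := by
      rw [hM z hz _ (add_nonneg ht hs) hV']
      simp only [hP]
      rw [mul_assoc, mul_assoc, hΓ.chain _ s ht hs z hz, ← hF.add _ s ht hs z hz,
        ← mul_assoc (expGroup C s), ← expGroup_add]
      congr 2
      ring
    change _ = Ring.inverse (P (T (F s z)) (F s z)) * expGroup C s * P (T z) z
    rw [mul_assoc, ← key, ← mul_assoc, Ring.inverse_mul_cancel _ (hunit _ hw), one_mul]

end Semicocycle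

end

theorem proposition3p8 {A : Type*} [NormedRing A] [NormOneClass A] [NormedAlgebra ℂ A]
    [CompleteSpace A]
    (F : ℝ → ℂ → ℂ) (hF : IsHolSemigroup F)
    (f : ℂ → ℂ) (hf : IsSemigroupGenerator F f)
    (z₀ : ℂ) (hz₀ : z₀ ∈ unitDisk) (hfz₀ : f z₀ = 0)
    (lam : ℂ) (hlam : lam = -deriv f z₀) (hre : 0 < lam.re)
    (B : ℂ → A) (hB : DifferentiableOn ℂ B unitDisk) :
    (∃ h : ℂ → ℂ, IsKoenigsFunction F z₀ lam h) ∧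
    ∀ h : ℂ → ℂ, IsKoenigsFunction F z₀ lam h →
      ∀ Γ : ℝ → ℂ → A, IsSemicocycle F Γ → IsSemicocycleGeneratedBy F Γ B →
        (IsLinearizable F Γ ↔ RecSolvable lam (B z₀) (koenigsCoeff B h)) := by
  have hl0 : lam ≠ 0 := fun h => by simp [h] at hre
  refine ⟨hf.exists_isKoenigsFunction hF hz₀ hfz₀ hlam hre, fun h hh Γ hΓ hΓB => ⟨?_, ?_⟩⟩
  · exact recSolvable_of_isLinearizable hF hf hz₀ hfz₀ hl0 hB hh hΓB
  · exact isLinearizable_of_recSolvable hF hf hz₀ hre hB hh hΓ hΓB
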